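/- Let $\mathcal{G}$ be a locally compact Hausdorff étale groupoid with unit space $\mathcal{G}^{(0)}$, source and range maps $\mathrm{s},\mathrm{r}$ and source fibres $\mathcal{G}_x=\mathrm{s}^{-1}(x)$. For $f\in C_c(\mathcal{G})$ and $x\in\mathcal{G}^{(0)}$ let $\lambda_x(f)\in\mathscr{B}(\ell^2(\mathcal{G}_x))$ be given by $(\lambda_x(f)\xi)(\gamma)=\sum_{\alpha\in\mathcal{G}_x}f(\gamma\alpha^{-1})\xi(\alpha)$, and let $C^*_r(\mathcal{G})$ be the completion of the convolution $*$-algebra $C_c(\mathcal{G})$ in the norm $\|f\|_r=\sup_{x\in\mathcal{G}^{(0)}}\|\lambda_x(f)\|$; each $\lambda_x$ extends to $C^*_r(\mathcal{G})$. Let $E:C^*_r(\mathcal{G})\to C_0(\mathcal{G}^{(0)})$, $E(a)(u)=\langle\lambda_u(a)\delta_u,\delta_u\rangle$, be the canonical conditional expectation. Let $\mu$ be a Radon probability measure on $\mathcal{G}^{(0)}$ that is invariant: for every open bisection $B\subseteq\mathcal{G}$ one has $(\alpha_B)_*(\mu|_{\mathrm{s}(B)})=\mu|_{\mathrm{r}(B)}$,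 where $\alpha_B=\mathrm{r}\circ(\mathrm{s}|_B)^{-1}:\mathrm{s}(B)\to\mathrm{r}(B)$. Put $\tau_\mu(a)=\int_{\mathcal{G}^{(0)}}E(a)\,d\mu$ and $I_\mu=\{a\in C^*_r(\mathcal{G}):\tau_\mu(a^*a)=0\}$. The support $\mathrm{supp}\,\mu$ is a closed invariant subset of $\mathcal{G}^{(0)}$; let $\mathcal{G}_{\mathrm{supp}\mu}=\mathrm{s}^{-1}(\mathrm{supp}\,\mu)$, again a locally compact Hausdorff étale groupoid. Then $I_\mu$ is a closed two-sided ideal of $C^*_r(\mathcal{G})$, and the restriction map $C_c(\mathcal{G})\to C_c(\mathcal{G}_{\mathrm{supp}\mu})$ extends to a $*$-homomorphism $\pi:C^*_r(\mathcal{G})\to C^*_r(\mathcal{G}_{\mathrm{supp}\mu})$ such that, with the inclusion $I_\mu\hookrightarrow C^*_r(\mathcal{G})$, \[ 0\longrightarrow I_\mu\longrightarrow C^*_r(\mathcal{G})\xrightarrow{\ \pi\ }C^*_r(\mathcal{G}_{\mathrm{supp}\mu})\longrightarrow 0 \] is a short exact sequence. -/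

import Mathlib

open MeasureTheory Topology Filter
open scoped CompactlySupported ENNReal ZeroAtInfty

universe u

namespace GroupoidCStar

/-! ### Groupoids and étale groupoids -/

/-- A groupoid, presented by its set `G` of arrows: a unit space `units ⊆ G`, source and range maps
`src, rng : G → units`, a multiplication defined exactly on the composable pairs
(those with `src a = rng b`) and an inversion. -/
class GroupoidOn (G : Type u) where
  units : Set G
  src : G → units
  rng : G → units
  mul : (a b : G) → src a = rng b → G
  inv : G → G
  src_unit : ∀ x : units, src (x : G) = x
  rng_unit : ∀ x : units, rng (x : G) = x
  src_mul : ∀ (a b : G) (h : src a = rng b), src (mul a b h) = src b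
  rng_mul : ∀ (a b : G) (h : src a = rng b), rng (mul a b h) = rng a
  mul_assoc : ∀ (a b c : G) (h : src a = rng b) (h' : src b = rng c),
    mul (mul a b h) c ((src_mul a b h).trans h') = mul a (mul b c h') (h.trans (rng_mul b c h').symm)
  mul_unit : ∀ a : G, mul a (src a) (rng_unit (src a)).symm = a
  unit_mul : ∀ a : G, mul (rng a) a (src_unit (rng a)) = a
  src_inv : ∀ a : G, src (inv a) = rng a
  rng_inv : ∀ a : G, rng (inv a) = src a
  inv_mul : ∀ a : G, mul (inv a) a (src_inv a) = src a
  mul_inv : ∀ a : G, mul a (inv a) (rng_inv a).symm = rng a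

open GroupoidOn

/-- The unit space `G⁽⁰⁾` of a groupoid (with the subspace topology when `G` has one). -/
abbrev UnitSpace (G : Type u) [GroupoidOn G] : Type u := (units : Set G)

/-- A topological groupoid: source, range, inversion and composition are continuous. -/
class IsTopGroupoid (G : Type u) [TopologicalSpace G] [GroupoidOn G] : Prop where
  continuous_src : Continuous (src : G → UnitSpace G)
  continuous_rng : Continuous (rng : G → UnitSpace G)
  continuous_inv : Continuous (inv : G → G)
  continuous_mul :
    Continuous fun p : {p : G × G // src p.1 = rng p.2} => mul p.1.1 p.1.2 p.2

/-- An étale groupoid: a topological groupoid whose range map is a local homeomorphism onto the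
unit space. -/
class IsEtale (G : Type u) [TopologicalSpace G] [GroupoidOn G] : Prop extends IsTopGroupoid G where
  isLocalHomeomorph_rng : IsLocalHomeomorph (rng : G → UnitSpace G)

section algebra

variable {G : Type u} [GroupoidOn G]

theorem mul_congr {a a' b b' : G} (h : src a = rng b) (ha : a = a') (hb : b = b') :
    mul a b h = mul a' b' (by subst ha hb; exact h) := by
  subst ha hb; rfl

theorem inv_mul_cancel_left (a b : G) (h : src a = rng b) :
    mul (inv a) (mul a b h) ((src_inv a).trans (rng_mul a b h).symm) = b := by
  rw [← mul_assoc (inv a) a b (src_inv a) h, mul_congr _ (inv_mul a) rfl]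
  refine Eq.trans ?_ (unit_mul b)
  exact mul_congr _ (congrArg Subtype.val h) rfl

theorem mul_inv_cancel_right (a b : G) (h : src a = rng b) :
    mul (mul a b h) (inv b) ((src_mul a b h).trans (rng_inv b).symm) = a := by
  rw [mul_assoc a b (inv b) h (rng_inv b).symm, mul_congr _ rfl (mul_inv b)]
  refine Eq.trans ?_ (mul_unit a)
  exact mul_congr _ rfl (congrArg Subtype.val h.symm)

theorem inv_unique (a b : G) (h : src a = rng b) (hm : mul a b h = rng a) : b = inv a := by
  have h1 := inv_mul_cancel_left a b h
  rw [mul_congr _ rfl hm] at h1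
  rw [← h1]
  refine Eq.trans ?_ (mul_unit (inv a))
  exact mul_congr _ rfl (congrArg Subtype.val (src_inv a).symm)

theorem inv_inv (a : G) : inv (inv a) = a := by
  refine (inv_unique (inv a) a (src_inv a) ?_).symm
  rw [inv_mul, rng_inv]

theorem inv_unit (x : UnitSpace G) : inv (x : G) = x := by
  refine (inv_unique (x : G) x ((src_unit x).trans (rng_unit x).symm) ?_).symm
  refine (mul_congr _ rfl (congrArg Subtype.val (src_unit x).symm)).trans ?_
  rw [mul_unit, rng_unit]

/-- The product `γ α⁻¹` of two arrows with the same source. -/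
def divR (γ α : G) (h : src γ = src α) : G := mul γ (inv α) (h.trans (rng_inv α).symm)

theorem src_divR (γ α : G) (h : src γ = src α) : src (divR γ α h) = rng α :=
  (src_mul _ _ _).trans (src_inv α)

theorem rng_divR (γ α : G) (h : src γ = src α) : rng (divR γ α h) = rng γ := rng_mul _ _ _

theorem divR_congr {a a' b b' : G} (h : src a = src b) (ha : a = a') (hb : b = b') :
    divR a b h = divR a' b' (by subst ha hb; exact h) := by
  subst ha hb; rfl

theorem divR_mul (γ α : G) (h : src γ = src α) :
    mul (divR γ α h) α (src_divR γ α h) = γ := by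
  have := mul_inv_cancel_right γ (inv α) (h.trans (rng_inv α).symm)
  rwa [mul_congr _ rfl (inv_inv α)] at this

theorem mul_divR (a b : G) (h : src a = rng b) : divR (mul a b h) b (src_mul a b h) = a :=
  mul_inv_cancel_right a b h

theorem divR_inj_left {γ γ' α : G} (h : src γ = src α) (h' : src γ' = src α)
    (e : divR γ α h = divR γ' α h') : γ = γ' := by
  rw [← divR_mul γ α h, ← divR_mul γ' α h']
  exact mul_congr _ e rfl

theorem divR_inj_right {γ α α' : G} (h : src γ = src α) (h' : src γ = src α')
    (e : divR γ α h = divR γ α' h') : α = α' := by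
  have h1 := inv_mul_cancel_left γ (inv α) (h.trans (rng_inv α).symm)
  have h2 := inv_mul_cancel_left γ (inv α') (h'.trans (rng_inv α').symm)
  have : inv α = inv α' := by
    rw [← h1, ← h2]
    exact mul_congr _ rfl e
  rw [← inv_inv α, this, inv_inv]

theorem inv_divR (γ α : G) (h : src γ = src α) : inv (divR γ α h) = divR α γ h.symm := by
  refine (inv_unique (divR γ α h) (divR α γ h.symm) ?_ ?_).symm
  · rw [src_divR, rng_divR]
  · have h1 := mul_assoc (divR γ α h) α (inv γ) (src_divR γ α h) (h.symm.trans (rng_inv γ).symm)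
    refine h1.symm.trans ?_
    rw [mul_congr _ (divR_mul γ α h) rfl, GroupoidOn.mul_inv, rng_divR]

theorem divR_divR (γ α β : G) (h : src γ = src α) (h' : src β = src α) :
    divR (divR γ α h) (divR β α h') (by rw [src_divR, src_divR]) = divR γ β (h.trans h'.symm) := by
  have e : inv (divR β α h') = divR α β h'.symm := inv_divR β α h'
  have h3 : src (divR γ α h) = rng (divR α β h'.symm) := by rw [src_divR, rng_divR]
  have h1 := GroupoidOn.mul_assoc (divR γ α h) α (inv β) (src_divR γ α h)
    (h'.symm.trans (rng_inv β).symm)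
  calc divR (divR γ α h) (divR β α h') _ = mul (divR γ α h) (divR α β h'.symm) h3 :=
        mul_congr _ rfl e
    _ = _ := h1.symm
    _ = divR γ β (h.trans h'.symm) := mul_congr _ (divR_mul γ α h) rfl

theorem divR_unit (γ : G) : divR γ (src γ : G) (src_unit (src γ)).symm = γ := by
  unfold divR
  rw [mul_congr _ rfl (inv_unit (src γ)), mul_unit]

/-- The source fibre `G_x`. -/
abbrev Fiber (x : UnitSpace G) : Type u := {γ : G // src γ = x}

theorem Fiber.src_eq {x : UnitSpace G} (γ α : Fiber x) : src γ.1 = src α.1 := γ.2.trans α.2.symm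

/-- The unit `x`, as a point of the fibre `G_x`. -/
def Fiber.unit (x : UnitSpace G) : Fiber x := ⟨(x : G), src_unit x⟩

end algebra

/-! ### Matrices with uniformly finite rows and columns as operators on `ℓ²` -/

section matrixOperator

variable {ι : Type u}

/-- The Hilbert space `ℓ²(ι)`. -/
abbrev Ell2 (ι : Type u) : Type u := lp (fun _ : ι => ℂ) 2

/-- A matrix with entries bounded by `C` and with at most `N` nonzero entries in each row and in
each column. -/
structure IsBoundedMatrix (k : ι → ι → ℂ) (N : ℕ) (C : ℝ) : Prop where
  norm_le : ∀ i j, ‖k i j‖ ≤ C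
  row : ∀ i, ∀ S : Finset ι, (∀ j ∈ S, k i j ≠ 0) → S.card ≤ N
  col : ∀ j, ∀ S : Finset ι, (∀ i ∈ S, k i j ≠ 0) → S.card ≤ N

theorem finite_of_card_le {s : Set ι} {N : ℕ} (h : ∀ S : Finset ι, (∀ j ∈ S, j ∈ s) → S.card ≤ N) :
    s.Finite := by
  by_contra hs
  obtain ⟨t, ht, hc⟩ := Set.Infinite.exists_subset_card_eq hs (N + 1)
  have := h t (fun j hj => ht hj)
  omega

theorem IsBoundedMatrix.row_finite {k : ι → ι → ℂ} {N : ℕ} {C : ℝ} (h : IsBoundedMatrix k N C)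
    (i : ι) : {j | k i j ≠ 0}.Finite :=
  finite_of_card_le (h.row i)

theorem IsBoundedMatrix.summable {k : ι → ι → ℂ} {N : ℕ} {C : ℝ} (h : IsBoundedMatrix k N C)
    (i : ι) (ξ : ι → ℂ) : Summable fun j => k i j * ξ j := by
  refine summable_of_ne_finset_zero (s := (h.row_finite i).toFinset) fun j hj => ?_
  have : k i j = 0 := by simpa using hj
  simp [this]

theorem IsBoundedMatrix.sum_le {k : ι → ι → ℂ} {N : ℕ} {C : ℝ} (h : IsBoundedMatrix k N C)
    (ξ : Ell2 ι) (S : Finset ι) :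
    ∑ i ∈ S, ‖∑' j, k i j * ξ j‖ ^ 2 ≤ (N * C * ‖ξ‖) ^ 2 := by
  classical
  have hC : ∀ i : ι, 0 ≤ C := fun i => (norm_nonneg _).trans (h.norm_le i i)
  let R : ι → Finset ι := fun i => (h.row_finite i).toFinset
  have hR : ∀ i j, j ∈ R i ↔ k i j ≠ 0 := fun i j => by simp [R]
  have h1 : ∀ i ∈ S, ‖∑' j, k i j * ξ j‖ ^ 2 ≤ N * C ^ 2 * ∑ j ∈ R i, ‖ξ j‖ ^ 2 := by
    intro i _
    rw [tsum_eq_sum (s := R i) (fun j hj => by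
      have : k i j = 0 := by simpa [hR] using hj
      simp [this])]
    calc ‖∑ j ∈ R i, k i j * ξ j‖ ^ 2 ≤ (∑ j ∈ R i, C * ‖ξ j‖) ^ 2 := by
          gcongr
          refine (norm_sum_le _ _).trans (Finset.sum_le_sum fun j _ => ?_)
          rw [norm_mul]
          gcongr
          exact h.norm_le i j
      _ ≤ (R i).card * ∑ j ∈ R i, (C * ‖ξ j‖) ^ 2 := sq_sum_le_card_mul_sum_sq
      _ ≤ N * ∑ j ∈ R i, (C * ‖ξ j‖) ^ 2 := by
          gcongr
          exact h.row i _ (fun j hj => (hR i j).1 hj)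
      _ = N * C ^ 2 * ∑ j ∈ R i, ‖ξ j‖ ^ 2 := by
          simp_rw [mul_pow, ← Finset.mul_sum]; ring
  have h2 : ∑ i ∈ S, ∑ j ∈ R i, ‖ξ j‖ ^ 2 ≤ N * ‖ξ‖ ^ 2 := by
    rw [Finset.sum_comm' (t' := S.biUnion R) (s' := fun j => S.filter fun i => j ∈ R i)]
    · calc ∑ j ∈ S.biUnion R, ∑ i ∈ S.filter (fun i => j ∈ R i), ‖ξ j‖ ^ 2
          ≤ ∑ j ∈ S.biUnion R, N * ‖ξ j‖ ^ 2 := by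
            refine Finset.sum_le_sum fun j _ => ?_
            rw [Finset.sum_const, nsmul_eq_mul]
            gcongr
            refine h.col j _ fun i hi => ?_
            exact (hR i j).1 (Finset.mem_filter.1 hi).2
        _ ≤ N * ‖ξ‖ ^ 2 := by
            rw [← Finset.mul_sum]
            gcongr
            simpa using lp.sum_rpow_le_norm_rpow (p := 2) (by simp) ξ (S.biUnion R)
    · intro i j
      simp only [Finset.mem_filter, Finset.mem_biUnion]
      exact ⟨fun h => ⟨⟨h.1, h.2⟩, i, h.1, h.2⟩, fun h => h.1⟩
  calc ∑ i ∈ S, ‖∑' j, k i j * ξ j‖ ^ 2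
      ≤ ∑ i ∈ S, N * C ^ 2 * ∑ j ∈ R i, ‖ξ j‖ ^ 2 := Finset.sum_le_sum h1
    _ = N * C ^ 2 * ∑ i ∈ S, ∑ j ∈ R i, ‖ξ j‖ ^ 2 := by rw [Finset.mul_sum]
    _ ≤ N * C ^ 2 * (N * ‖ξ‖ ^ 2) := by gcongr
    _ = (N * C * ‖ξ‖) ^ 2 := by ring

/-- The bounded operator on `ℓ²(ι)` given by a matrix: `(k ξ)(i) = ∑ j, k i j ξ(j)`. -/
noncomputable def matrixOp (k : ι → ι → ℂ) {N : ℕ} {C : ℝ} (h : IsBoundedMatrix k N C) :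
    Ell2 ι →L[ℂ] Ell2 ι :=
  LinearMap.mkContinuousOfExistsBound
    { toFun := fun ξ => ⟨fun i => ∑' j, k i j * ξ j, by
        refine memℓp_gen' (C := (N * C * ‖ξ‖) ^ 2) fun S => ?_
        simpa using h.sum_le ξ S⟩
      map_add' := fun ξ η => by
        ext i
        simp only [lp.coeFn_add, Pi.add_apply, mul_add]
        exact (h.summable i ξ).tsum_add (h.summable i η)
      map_smul' := fun c ξ => by
        ext i
        simp only [lp.coeFn_smul, Pi.smul_apply, smul_eq_mul, RingHom.id_apply]
        rw [← tsum_mul_left]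
        exact tsum_congr fun j => by ring }
    ⟨N * |C|, fun ξ => by
      refine lp.norm_le_of_forall_sum_le (by simp) (by positivity) fun S => ?_
      have := h.sum_le ξ S
      simp only [ENNReal.toReal_ofNat, Real.rpow_ofNat]
      refine this.trans ?_
      rw [mul_pow, mul_pow, mul_pow, mul_pow, sq_abs]⟩

theorem matrixOp_apply {k : ι → ι → ℂ} {N : ℕ} {C : ℝ} (h : IsBoundedMatrix k N C) (ξ : Ell2 ι)
    (i : ι) : matrixOp k h ξ i = ∑' j, k i j * ξ j := rfl

theorem matrixOp_norm_le {k : ι → ι → ℂ} {N : ℕ} {C : ℝ} (h : IsBoundedMatrix k N C) (hC : 0 ≤ C) :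
    ‖matrixOp k h‖ ≤ N * C := by
  refine ContinuousLinearMap.opNorm_le_bound _ (by positivity) fun ξ => ?_
  refine lp.norm_le_of_forall_sum_le (by simp) (by positivity) fun S => ?_
  simpa [matrixOp_apply] using h.sum_le ξ S

/-- The basis vector `δ_i` of `ℓ²(ι)`. -/
noncomputable def delta (i : ι) : Ell2 ι := by
  classical exact lp.single 2 i (1 : ℂ)

theorem norm_delta (i : ι) : ‖(delta i : Ell2 ι)‖ = 1 := by
  classical
  unfold delta
  refine (lp.norm_single (E := fun _ : ι => ℂ) (p := 2) (by norm_num) i (1 : ℂ)).trans ?_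
  simp

theorem inner_delta_left (i : ι) (ξ : Ell2 ι) : inner ℂ (delta i) ξ = ξ i := by
  classical
  have := lp.inner_single_left (𝕜 := ℂ) (G := fun _ : ι => ℂ) i (1 : ℂ) ξ
  unfold delta
  convert this using 1
  simp

theorem matrixOp_delta {k : ι → ι → ℂ} {N : ℕ} {C : ℝ} (h : IsBoundedMatrix k N C) (i j : ι) :
    matrixOp k h (delta j) i = k i j := by
  classical
  rw [matrixOp_apply, tsum_eq_single j]
  · simp [delta]
  · intro l hl
    have : (delta j : Ell2 ι) l = 0 := by
      unfold delta
      exact lp.single_apply_ne (E := fun _ : ι => ℂ) 2 j (1 : ℂ) hl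
    rw [this, mul_zero]

theorem ext_delta {A B : Ell2 ι →L[ℂ] Ell2 ι} (h : ∀ i j, A (delta j) i = B (delta j) i) :
    A = B := by
  classical
  have key : ∀ j, A (delta j) = B (delta j) := fun j => by
    ext i; exact h i j
  ext1 ξ
  have hs := lp.hasSum_single (p := 2) (by simp) ξ
  have e : ∀ j, lp.single 2 j (ξ j) = ξ j • (delta j : Ell2 ι) := fun j => by
    unfold delta
    rw [← lp.single_smul]; simp
  have hA := (A.hasSum hs)
  have hB := (B.hasSum hs)
  refine hA.unique ?_
  convert hB using 2 with j
  rw [e, map_smul, map_smul, key]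

end matrixOperator

/-! ### Topology of étale groupoids -/

section topology

open IsTopGroupoid

variable {G : Type u} [TopologicalSpace G] [GroupoidOn G]

/-- Inversion as a homeomorphism. -/
def invHomeo (G : Type u) [TopologicalSpace G] [GroupoidOn G] [IsTopGroupoid G] : G ≃ₜ G where
  toFun := inv
  invFun := inv
  left_inv := inv_inv
  right_inv := inv_inv
  continuous_toFun := continuous_inv
  continuous_invFun := continuous_inv

theorem isLocalHomeomorph_src [IsEtale G] : IsLocalHomeomorph (src : G → UnitSpace G) := by
  have h := (IsEtale.isLocalHomeomorph_rng (G := G)).comp (invHomeo G).isLocalHomeomorph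
  have e : (rng : G → UnitSpace G) ∘ (invHomeo G) = src := funext fun a => rng_inv a
  rwa [e] at h

theorem exists_card_le_of_isLocalHomeomorph {X Y : Type u} [TopologicalSpace X]
    [TopologicalSpace Y] {p : X → Y} (hp : IsLocalHomeomorph p) {K : Set X} (hK : IsCompact K) :
    ∃ N : ℕ, ∀ (y : Y) (S : Finset X), (∀ a ∈ S, a ∈ K ∧ p a = y) → S.card ≤ N := by
  classical
  choose e he hpe using hp
  obtain ⟨t, -, ht⟩ := hK.elim_nhds_subcover (fun a => (e a).source)
    (fun a _ => (e a).open_source.mem_nhds (he a))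
  refine ⟨t.card, fun y S hS => ?_⟩
  have hc : ∀ a ∈ S, ∃ i ∈ t, a ∈ (e i).source := fun a ha => by
    have := ht (hS a ha).1
    simpa using this
  choose! c hct hca using hc
  refine Finset.card_le_card_of_injOn c hct fun a ha b hb hab => ?_
  have ha' := hca a ha
  have hb' := hca b hb
  rw [← hab] at hb'
  refine (e (c a)).injOn ha' hb' ?_
  rw [← hpe, (hS a ha).2, (hS b hb).2]

theorem exists_card_le [IsEtale G] {K : Set G} (hK : IsCompact K) :
    ∃ N : ℕ, (∀ (y : UnitSpace G) (S : Finset G), (∀ a ∈ S, a ∈ K ∧ src a = y) → S.card ≤ N) ∧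
      ∀ (y : UnitSpace G) (S : Finset G), (∀ a ∈ S, a ∈ K ∧ rng a = y) → S.card ≤ N := by
  obtain ⟨N, hN⟩ := exists_card_le_of_isLocalHomeomorph (isLocalHomeomorph_src (G := G)) hK
  obtain ⟨M, hM⟩ := exists_card_le_of_isLocalHomeomorph
    (IsEtale.isLocalHomeomorph_rng (G := G)) hK
  exact ⟨max N M, fun y S hS => (hN y S hS).trans (le_max_left _ _),
    fun y S hS => (hM y S hS).trans (le_max_right _ _)⟩

theorem exists_norm_le {X : Type u} [TopologicalSpace X] (f : C_c(X, ℂ)) :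
    ∃ C : ℝ, 0 ≤ C ∧ ∀ a, ‖f a‖ ≤ C := by
  obtain ⟨C, hC⟩ := f.hasCompactSupport.exists_bound_of_continuous f.continuous
  exact ⟨max C 0, le_max_right _ _, fun a => (hC a).trans (le_max_left _ _)⟩

end topology

/-! ### The regular representations -/

section fiberOps

variable {G : Type u} [GroupoidOn G]

/-- The C⋆-algebra `∏_x B(ℓ²(G_x))` of uniformly bounded families of operators, with the
supremum norm. -/
def FiberOps (G : Type u) [GroupoidOn G] : Type u :=
  ↥(lp (fun x : UnitSpace G => Ell2 (Fiber x) →L[ℂ] Ell2 (Fiber x)) ∞)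

noncomputable instance : NonUnitalCStarAlgebra (FiberOps G) :=
  inferInstanceAs (NonUnitalCStarAlgebra
    ↥(lp (fun x : UnitSpace G => Ell2 (Fiber x) →L[ℂ] Ell2 (Fiber x)) ∞))

/-- The component at `x` of a family of operators. -/
def FiberOps.component (T : FiberOps G) (x : UnitSpace G) : Ell2 (Fiber x) →L[ℂ] Ell2 (Fiber x) := T.1 x

theorem FiberOps.ext {S T : FiberOps G} (h : ∀ x, S.component x = T.component x) : S = T := lp.ext (funext h)

theorem FiberOps.norm_component_le (T : FiberOps G) (x : UnitSpace G) : ‖T.component x‖ ≤ ‖T‖ :=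
  lp.norm_apply_le_norm ENNReal.top_ne_zero
    (show lp (fun x : UnitSpace G => Ell2 (Fiber x) →L[ℂ] Ell2 (Fiber x)) ∞ from T) x

end fiberOps

section regularRepresentation

variable {G : Type u} [TopologicalSpace G] [GroupoidOn G]

/-- The matrix `(γ, α) ↦ f(γ α⁻¹)` of the left regular representation on `ℓ²(G_x)`. -/
def regMatrix (f : G → ℂ) (x : UnitSpace G) : Fiber x → Fiber x → ℂ :=
  fun γ α => f (divR γ.1 α.1 (γ.src_eq α))

theorem exists_isBoundedMatrix [IsEtale G] (f : C_c(G, ℂ)) :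
    ∃ NC : ℕ × ℝ, 0 ≤ NC.2 ∧ ∀ x : UnitSpace G, IsBoundedMatrix (regMatrix f x) NC.1 NC.2 := by
  classical
  obtain ⟨C, hC0, hC⟩ := exists_norm_le f
  obtain ⟨N, hN, hN'⟩ := exists_card_le (G := G) f.hasCompactSupport.isCompact
  refine ⟨(N, C), hC0, fun x => ⟨fun i j => hC _, fun γ S hS => ?_, fun α S hS => ?_⟩⟩
  · have hinj : Function.Injective fun α : Fiber x => divR γ.1 α.1 (γ.src_eq α) :=
      fun α β h => Subtype.ext (divR_inj_right _ _ h)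
    rw [← Finset.card_image_of_injective S hinj]
    refine hN' (rng γ.1) _ fun a ha => ?_
    obtain ⟨α, hα, rfl⟩ := Finset.mem_image.1 ha
    exact ⟨subset_tsupport _ (hS α hα), rng_divR _ _ _⟩
  · have hinj : Function.Injective fun γ : Fiber x => divR γ.1 α.1 (γ.src_eq α) :=
      fun γ β h => Subtype.ext (divR_inj_left _ _ h)
    rw [← Finset.card_image_of_injective S hinj]
    refine hN (rng α.1) _ fun a ha => ?_
    obtain ⟨γ, hγ, rfl⟩ := Finset.mem_image.1 ha
    exact ⟨subset_tsupport _ (hS γ hγ), src_divR _ _ _⟩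

/-- The left regular representation at `x`:
`(λ_x(f) ξ)(γ) = ∑_{α ∈ G_x} f(γ α⁻¹) ξ(α)` on `ℓ²(G_x)`. -/
noncomputable def leftReg [IsEtale G] (x : UnitSpace G) (f : C_c(G, ℂ)) :
    Ell2 (Fiber x) →L[ℂ] Ell2 (Fiber x) :=
  matrixOp (regMatrix f x) ((exists_isBoundedMatrix f).choose_spec.2 x)

theorem leftReg_apply [IsEtale G] (x : UnitSpace G) (f : C_c(G, ℂ)) (ξ : Ell2 (Fiber x))
    (γ : Fiber x) :
    leftReg x f ξ γ = ∑' α : Fiber x, f (divR γ.1 α.1 (γ.src_eq α)) * ξ α := rfl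

theorem leftReg_delta [IsEtale G] (x : UnitSpace G) (f : C_c(G, ℂ)) (γ α : Fiber x) :
    leftReg x f (delta α) γ = f (divR γ.1 α.1 (γ.src_eq α)) := matrixOp_delta _ _ _

/-- The family `(λ_x(f))_x`; its norm is the reduced norm `sup_x ‖λ_x(f)‖` of `f`. -/
noncomputable def regRep (G : Type u) [TopologicalSpace G] [GroupoidOn G] [IsEtale G] :
    C_c(G, ℂ) →ₗ[ℂ] FiberOps G where
  toFun f := ⟨fun x => leftReg x f, memℓp_infty ⟨(exists_isBoundedMatrix f).choose.1 *
    (exists_isBoundedMatrix f).choose.2, by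
      rintro _ ⟨x, rfl⟩
      exact matrixOp_norm_le _ (exists_isBoundedMatrix f).choose_spec.1⟩⟩
  map_add' f g := by
    refine FiberOps.ext fun x => ext_delta fun γ α => ?_
    change leftReg x (f + g) (delta α) γ = (leftReg x f (delta α) + leftReg x g (delta α)) γ
    simp [leftReg_delta]
  map_smul' c f := by
    refine FiberOps.ext fun x => ext_delta fun γ α => ?_
    change leftReg x (c • f) (delta α) γ = (c • leftReg x f (delta α)) γ
    simp [leftReg_delta]

theorem regRep_apply [IsEtale G] (f : C_c(G, ℂ)) (x : UnitSpace G) :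
    (regRep G f).component x = leftReg x f := rfl

end regularRepresentation

/-! ### The convolution algebra `C_c(G)` -/

section convolution

open IsTopGroupoid

variable {G : Type u} [TopologicalSpace G] [GroupoidOn G]

/-- Convolution: `(f * g)(γ) = ∑_{α ∈ G_{s(γ)}} f(γ α⁻¹) g(α)`. -/
noncomputable def convFun (f g : G → ℂ) (γ : G) : ℂ :=
  ∑' α : Fiber (src γ), f (divR γ α.1 α.2.symm) * g α.1

theorem finite_fiber_support [IsEtale G] (g : C_c(G, ℂ)) (x : UnitSpace G) :
    {α : Fiber x | g α.1 ≠ 0}.Finite := by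
  classical
  obtain ⟨N, hN, -⟩ := exists_card_le (G := G) g.hasCompactSupport.isCompact
  refine finite_of_card_le (N := N) fun S hS => ?_
  rw [← Finset.card_image_of_injective S Subtype.val_injective]
  refine hN x _ fun a ha => ?_
  obtain ⟨α, hα, rfl⟩ := Finset.mem_image.1 ha
  exact ⟨subset_tsupport _ (hS α hα), α.2⟩

theorem summable_conv [IsEtale G] (f : G → ℂ) (g : C_c(G, ℂ)) (γ : G) :
    Summable fun α : Fiber (src γ) => f (divR γ α.1 α.2.symm) * g α.1 := by
  refine summable_of_ne_finset_zero (s := (finite_fiber_support g (src γ)).toFinset) fun j hj => ?_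
  have : g j.1 = 0 := by simpa using hj
  simp [this]

theorem convFun_sum [IsEtale G] {n : ℕ} (f : G → ℂ) (g : Fin n → C_c(G, ℂ)) (γ : G) :
    convFun f (fun a => ∑ i, g i a) γ = ∑ i, convFun f (g i) γ := by
  unfold convFun
  rw [← Summable.tsum_finsetSum fun i _ => summable_conv f (g i) γ]
  exact tsum_congr fun α => by rw [Finset.mul_sum]

theorem continuous_convFun_of_subset [T2Space G] [IsEtale G] {f g : G → ℂ} (hf : Continuous f)
    (hg : Continuous g) (hgc : HasCompactSupport g) (e : OpenPartialHomeomorph G (UnitSpace G))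
    (he : (src : G → UnitSpace G) = e) (hs : tsupport g ⊆ e.source) :
    Continuous (convFun f g) := by
  have hsrc : Continuous (src : G → UnitSpace G) := continuous_src
  -- on the saturation of the section the sum has exactly one possibly nonzero term
  have hval : ∀ γ : G, ∀ h : src γ ∈ e.target, ∀ hh : src γ = src (e.symm (src γ)),
      convFun f g γ = f (divR γ (e.symm (src γ)) hh) * g (e.symm (src γ)) := by
    intro γ h hh
    unfold convFun
    rw [tsum_eq_single (⟨e.symm (src γ), hh.symm⟩ : Fiber (src γ))]
    intro α hα
    by_cases hgα : g α.1 = 0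
    · simp [hgα]
    · exfalso
      apply hα
      apply Subtype.ext
      have h1 : α.1 ∈ e.source := hs (subset_tsupport _ hgα)
      rw [← e.left_inv h1, ← he, α.2]
  rw [continuous_iff_continuousAt]
  intro γ
  by_cases hγ : src γ ∈ src '' (tsupport g)
  · have hopen : IsOpen ((src : G → UnitSpace G) ⁻¹' e.target) := e.open_target.preimage hsrc
    have hmem : γ ∈ (src : G → UnitSpace G) ⁻¹' e.target := by
      obtain ⟨α, hα, hαγ⟩ := hγ
      change src γ ∈ e.target
      rw [← hαγ, he]
      exact e.map_source (hs hα)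
    refine ContinuousOn.continuousAt ?_ (hopen.mem_nhds hmem)
    rw [continuousOn_iff_continuous_domRestrict]
    have hsec : ∀ y ∈ e.target, src (e.symm y) = y := fun y hy => by
      rw [he]; exact e.right_inv hy
    have hcs : Continuous fun v : ((src : G → UnitSpace G) ⁻¹' e.target) => e.symm (src v.1) :=
      e.continuousOn_symm.comp_continuous (hsrc.comp continuous_subtype_val) fun v => v.2
    have hd : Continuous fun v : ((src : G → UnitSpace G) ⁻¹' e.target) =>
        divR v.1 (e.symm (src v.1)) (hsec _ v.2).symm := by
      unfold divR
      exact continuous_mul.comp (Continuous.subtype_mk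
        (continuous_subtype_val.prodMk (IsTopGroupoid.continuous_inv.comp hcs))
        fun v => (hsec _ v.2).symm.trans (rng_inv _).symm)
    refine ((hf.comp hd).mul (hg.comp hcs)).congr fun v => ?_
    exact (hval v.1 v.2 (hsec _ v.2).symm).symm
  · have hcl : IsClosed (src '' (tsupport g) : Set (UnitSpace G)) :=
      (hgc.isCompact.image hsrc).isClosed
    have hev : ∀ᶠ γ' in 𝓝 γ, convFun f g γ' = 0 := by
      filter_upwards [(hcl.isOpen_compl.preimage hsrc).mem_nhds hγ] with γ' hγ'
      refine (tsum_congr fun α => ?_).trans tsum_zero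
      by_cases hgα : g α.1 = 0
      · simp [hgα]
      · exact absurd ⟨α.1, subset_tsupport _ hgα, α.2⟩ hγ'
    exact (continuousAt_const (y := (0 : ℂ))).congr (hev.mono fun _ h => h.symm)

theorem exists_decomposition [T2Space G] [LocallyCompactSpace G] [IsEtale G] (g : C_c(G, ℂ)) :
    ∃ (n : ℕ) (gi : Fin n → C_c(G, ℂ)), (∀ a, g a = ∑ i, gi i a) ∧
      ∀ i, ∃ e : OpenPartialHomeomorph G (UnitSpace G), (src : G → UnitSpace G) = e ∧
        tsupport (gi i) ⊆ e.source := by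
  classical
  choose e he hpe using isLocalHomeomorph_src (G := G)
  obtain ⟨t, ht⟩ := g.hasCompactSupport.isCompact.elim_nhds_subcover
    (fun a => (e a).source) (fun a _ => (e a).open_source.mem_nhds (he a))
  obtain ⟨φ, hφs, hφ1, -, hφc⟩ := exists_continuous_sum_one_of_isOpen_isCompact
    (s := fun i : Fin t.card => (e (t.equivFin.symm i).1).source)
    (fun i => (e _).open_source) g.hasCompactSupport.isCompact (by
      intro a ha
      obtain ⟨b, hb, hab⟩ := Set.mem_iUnion₂.1 (ht.2 ha)
      refine Set.mem_iUnion.2 ⟨t.equivFin ⟨b, hb⟩, ?_⟩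
      simpa using hab)
  have hsupp : ∀ i, tsupport (fun a => ((φ i a : ℝ) : ℂ) * g a) ⊆ tsupport (φ i) := fun i =>
    closure_mono fun a ha hz => ha (by simp [hz])
  refine ⟨t.card, fun i => ⟨⟨fun a => ((φ i a : ℝ) : ℂ) * g a, by fun_prop⟩,
    (hφc i).mono' ?_⟩, fun a => ?_, fun i => ⟨e (t.equivFin.symm i).1, hpe _, ?_⟩⟩
  · exact subset_closure.trans (hsupp i)
  · change g a = ∑ i, ((φ i a : ℝ) : ℂ) * g a
    rw [← Finset.sum_mul]
    by_cases ha : g a = 0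
    · simp [ha]
    · have := hφ1 (subset_tsupport _ ha)
      simp only [Finset.sum_apply, Pi.one_apply] at this
      rw [← Complex.ofReal_sum, this]
      simp
  · exact (hsupp i).trans (hφs i)

theorem continuous_convFun [T2Space G] [LocallyCompactSpace G] [IsEtale G] (f g : C_c(G, ℂ)) :
    Continuous (convFun f g) := by
  obtain ⟨n, gi, hsum, hgi⟩ := exists_decomposition g
  have e : convFun f g = fun γ => ∑ i, convFun f (gi i) γ := by
    funext γ
    rw [← convFun_sum]
    congr 1
    exact funext hsum
  rw [e]
  refine continuous_finsetSum _ fun i _ => ?_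
  obtain ⟨e, he, hs⟩ := hgi i
  exact continuous_convFun_of_subset f.continuous (gi i).continuous (gi i).hasCompactSupport e he hs

theorem hasCompactSupport_convFun [T2Space G] [IsEtale G] (f g : C_c(G, ℂ)) :
    HasCompactSupport (convFun f g) := by
  have hcl : IsClosed {p : G × G | src p.1 = rng p.2} :=
    isClosed_eq (continuous_src.comp continuous_fst) (continuous_rng.comp continuous_snd)
  have hK : IsCompact ((fun p : {p : G × G // src p.1 = rng p.2} => p.1) ⁻¹'
      (tsupport f ×ˢ tsupport g)) :=
    hcl.isClosedEmbedding_subtypeVal.isCompact_preimage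
      (f.hasCompactSupport.isCompact.prod g.hasCompactSupport.isCompact)
  refine HasCompactSupport.intro (hK.image continuous_mul) fun γ hγ => ?_
  refine (tsum_congr fun α => ?_).trans tsum_zero
  by_contra hne
  apply hγ
  have hf : f (divR γ α.1 α.2.symm) ≠ 0 := fun h => hne (by simp [h])
  have hg : g α.1 ≠ 0 := fun h => hne (by simp [h])
  exact ⟨⟨(divR γ α.1 α.2.symm, α.1), src_divR γ α.1 α.2.symm⟩,
    ⟨subset_tsupport _ hf, subset_tsupport _ hg⟩, divR_mul γ α.1 α.2.symm⟩

/-- The convolution product on `C_c(G)`. -/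
noncomputable def conv [T2Space G] [LocallyCompactSpace G] [IsEtale G] (f g : C_c(G, ℂ)) :
    C_c(G, ℂ) where
  toFun := convFun f g
  continuous_toFun := continuous_convFun f g
  hasCompactSupport' := hasCompactSupport_convFun f g

/-- The involution on `C_c(G)`: `f*(γ)` is the conjugate of `f(γ⁻¹)`. -/
noncomputable def involution [IsTopGroupoid G] (f : C_c(G, ℂ)) : C_c(G, ℂ) where
  toFun γ := star (f (inv γ))
  continuous_toFun := continuous_star.comp (f.continuous.comp continuous_inv)
  hasCompactSupport' :=
    (f.hasCompactSupport.comp_homeomorph (invHomeo G)).comp_left (g := (star : ℂ → ℂ)) (star_zero ℂ)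

theorem leftReg_conv [T2Space G] [LocallyCompactSpace G] [IsEtale G] (x : UnitSpace G)
    (f g : C_c(G, ℂ)) : leftReg x (conv f g) = leftReg x f * leftReg x g := by
  refine ext_delta fun γ α => ?_
  rw [leftReg_delta]
  change convFun f g _ = leftReg x f (leftReg x g (delta α)) γ
  rw [leftReg_apply]
  have hs : src (divR γ.1 α.1 (γ.src_eq α)) = rng α.1 := src_divR _ _ _
  let φ : Fiber x ≃ Fiber (src (divR γ.1 α.1 (γ.src_eq α))) :=
    { toFun := fun β => ⟨divR β.1 α.1 (β.src_eq α), (src_divR _ _ _).trans hs.symm⟩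
      invFun := fun δ => ⟨mul δ.1 α.1 (δ.2.trans hs), (src_mul _ _ _).trans α.2⟩
      left_inv := fun β => Subtype.ext (divR_mul β.1 α.1 (β.src_eq α))
      right_inv := fun δ => Subtype.ext (mul_divR δ.1 α.1 (δ.2.trans hs)) }
  unfold convFun
  rw [← φ.tsum_eq]
  refine tsum_congr fun β => ?_
  rw [leftReg_delta]
  congr 2
  exact divR_divR γ.1 α.1 β.1 (γ.src_eq α) (β.src_eq α)

theorem leftReg_involution [IsEtale G] (x : UnitSpace G) (f : C_c(G, ℂ)) :
    leftReg x (involution f) = star (leftReg x f) := by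
  refine ext_delta fun γ α => ?_
  rw [leftReg_delta, ← inner_delta_left, ContinuousLinearMap.star_eq_adjoint,
    ContinuousLinearMap.adjoint_inner_right, ← inner_conj_symm, inner_delta_left, leftReg_delta]
  change star (f (inv (divR γ.1 α.1 _))) = star _
  rw [inv_divR]

end convolution

/-! ### The reduced C⋆-algebra -/

section reduced

variable {G : Type u} [TopologicalSpace G] [GroupoidOn G] [T2Space G] [LocallyCompactSpace G]
  [IsEtale G]

/-- The image of `C_c(G)` in `∏_x B(ℓ²(G_x))`, a `*`-algebra since convolution and involution of
`C_c(G)` correspond to product and adjoint. -/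
noncomputable def ccImage (G : Type u) [TopologicalSpace G] [GroupoidOn G] [T2Space G]
    [LocallyCompactSpace G] [IsEtale G] : NonUnitalStarSubalgebra ℂ (FiberOps G) where
  carrier := Set.range (regRep G)
  add_mem' := by
    rintro _ _ ⟨f, rfl⟩ ⟨g, rfl⟩
    exact ⟨f + g, map_add _ _ _⟩
  zero_mem' := ⟨0, map_zero _⟩
  smul_mem' := by
    rintro c _ ⟨f, rfl⟩
    exact ⟨c • f, map_smul _ _ _⟩
  mul_mem' := by
    rintro _ _ ⟨f, rfl⟩ ⟨g, rfl⟩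
    refine ⟨conv f g, ?_⟩
    refine FiberOps.ext fun x => ?_
    exact leftReg_conv x f g
  star_mem' := by
    rintro _ ⟨f, rfl⟩
    refine ⟨involution f, ?_⟩
    refine FiberOps.ext fun x => ?_
    exact leftReg_involution x f

/-- The reduced groupoid C⋆-algebra `C*_r(G)`: the completion of `C_c(G)` in the reduced norm
`‖f‖_r = sup_x ‖λ_x(f)‖`, realised as the norm closure of `{(λ_x(f))_x : f ∈ C_c(G)}` in
`∏_x B(ℓ²(G_x))`. -/
noncomputable def reducedSubalgebra (G : Type u) [TopologicalSpace G] [GroupoidOn G] [T2Space G]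
    [LocallyCompactSpace G] [IsEtale G] : NonUnitalStarSubalgebra ℂ (FiberOps G) :=
  (ccImage G).topologicalClosure

/-- The reduced groupoid C⋆-algebra `C*_r(G)` as a type. -/
abbrev ReducedCStarAlgebra (G : Type u) [TopologicalSpace G] [GroupoidOn G] [T2Space G]
    [LocallyCompactSpace G] [IsEtale G] : Type u := reducedSubalgebra G

instance : IsClosed (reducedSubalgebra G : Set (FiberOps G)) :=
  (ccImage G).isClosed_topologicalClosure

/-- The canonical embedding `C_c(G) → C*_r(G)`. -/
noncomputable def ofCc (f : C_c(G, ℂ)) : ReducedCStarAlgebra G :=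
  ⟨regRep G f, (ccImage G).le_topologicalClosure ⟨f, rfl⟩⟩

theorem norm_ofCc (f : C_c(G, ℂ)) : ‖ofCc f‖ = ⨆ x : UnitSpace G, ‖leftReg x f‖ := rfl

theorem denseRange_ofCc : DenseRange (ofCc : C_c(G, ℂ) → ReducedCStarAlgebra G) := by
  intro a
  rw [Metric.mem_closure_iff]
  intro ε hε
  have ha : a.1 ∈ closure (Set.range (regRep G)) := a.2
  obtain ⟨_, ⟨f, rfl⟩, hf⟩ := Metric.mem_closure_iff.1 ha ε hε
  exact ⟨ofCc f, ⟨f, rfl⟩, hf⟩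

theorem ofCc_injective : Function.Injective (ofCc : C_c(G, ℂ) → ReducedCStarAlgebra G) := by
  intro f g h
  ext γ
  have h1 : leftReg (src γ) f = leftReg (src γ) g :=
    congrArg (fun a : ReducedCStarAlgebra G => a.1.component (src γ)) h
  have key : ∀ k : C_c(G, ℂ),
      leftReg (src γ) k (delta (Fiber.unit (src γ))) (⟨γ, rfl⟩ : Fiber (src γ)) = k γ := fun k =>
    (leftReg_delta (src γ) k ⟨γ, rfl⟩ (Fiber.unit (src γ))).trans (congrArg k (divR_unit γ))
  rw [← key f, h1, key g]

theorem ofCc_conv (f g : C_c(G, ℂ)) : ofCc (conv f g) = ofCc f * ofCc g :=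
  Subtype.ext (FiberOps.ext fun x => leftReg_conv x f g)

theorem ofCc_involution (f : C_c(G, ℂ)) : ofCc (involution f) = star (ofCc f) :=
  Subtype.ext (FiberOps.ext fun x => leftReg_involution x f)

/-- The left regular representation at `x`, extended to `C*_r(G)`. -/
def evalReg (x : UnitSpace G) (a : ReducedCStarAlgebra G) :
    Ell2 (Fiber x) →L[ℂ] Ell2 (Fiber x) := a.1.component x

end reduced

/-! ### The conditional expectation, invariant measures and traces -/

section expectation

open IsTopGroupoid

variable {G : Type u} [TopologicalSpace G] [GroupoidOn G]

theorem isClosed_units [T2Space G] [IsTopGroupoid G] : IsClosed (units : Set G) := by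
  have e : (units : Set G) = {γ : G | ((rng γ : UnitSpace G) : G) = γ} := by
    ext γ
    refine ⟨fun h => congrArg Subtype.val (rng_unit ⟨γ, h⟩), fun h => ?_⟩
    have h' : ((rng γ : UnitSpace G) : G) = γ := h
    rw [← h']
    exact (rng γ).2
  rw [e]
  exact isClosed_eq (continuous_subtype_val.comp continuous_rng) continuous_id

variable [T2Space G] [LocallyCompactSpace G] [IsEtale G]

/-- `E(a)(u) = ⟨λ_u(a) δ_u, δ_u⟩`, as a function on the unit space. (Mathlib's inner product is
conjugate-linear in the first variable.) -/
noncomputable def expectationFun (a : ReducedCStarAlgebra G) (u : UnitSpace G) : ℂ :=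
  inner ℂ (delta (Fiber.unit u)) (evalReg u a (delta (Fiber.unit u)))

theorem expectationFun_ofCc (f : C_c(G, ℂ)) (u : UnitSpace G) :
    expectationFun (ofCc f) u = f (u : G) := by
  unfold expectationFun
  rw [inner_delta_left]
  refine (leftReg_delta u f (Fiber.unit u) (Fiber.unit u)).trans (congrArg f ?_)
  refine (divR_congr _ rfl (congrArg Subtype.val (src_unit u)).symm).trans ?_
  exact divR_unit (u : G)

theorem norm_expectationFun_sub_le (a b : ReducedCStarAlgebra G) (u : UnitSpace G) :
    ‖expectationFun a u - expectationFun b u‖ ≤ ‖a - b‖ := by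
  have hδ : ‖(delta (Fiber.unit u) : Ell2 (Fiber u))‖ = 1 := norm_delta _
  unfold expectationFun
  rw [← inner_sub_right, ← sub_apply]
  refine (norm_inner_le_norm _ _).trans ?_
  rw [hδ, one_mul]
  refine (ContinuousLinearMap.le_opNorm _ _).trans ?_
  rw [hδ, mul_one]
  exact FiberOps.norm_component_le (a.1 - b.1) u

theorem exists_ofCc_near (a : ReducedCStarAlgebra G) {ε : ℝ} (hε : 0 < ε) :
    ∃ f : C_c(G, ℂ), ‖a - ofCc f‖ < ε := by
  obtain ⟨f, hf⟩ := denseRange_ofCc.exists_dist_lt a hε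
  exact ⟨f, by rwa [dist_eq_norm] at hf⟩

theorem continuous_expectationFun (a : ReducedCStarAlgebra G) : Continuous (expectationFun a) := by
  refine continuous_of_uniform_approx_of_continuous fun U hU => ?_
  obtain ⟨ε, hε, hεU⟩ := Metric.mem_uniformity_dist.1 hU
  obtain ⟨f, hf⟩ := exists_ofCc_near a hε
  refine ⟨fun u => f (u : G), f.continuous.comp continuous_subtype_val, fun u => hεU ?_⟩
  change dist (expectationFun a u) (f (u : G)) < ε
  rw [← expectationFun_ofCc, dist_eq_norm]
  exact (norm_expectationFun_sub_le _ _ _).trans_lt hf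

theorem tendsto_expectationFun (a : ReducedCStarAlgebra G) :
    Tendsto (expectationFun a) (cocompact (UnitSpace G)) (𝓝 0) := by
  rw [Metric.tendsto_nhds]
  intro ε hε
  obtain ⟨f, hf⟩ := exists_ofCc_near a hε
  have hK : IsCompact ((Subtype.val : UnitSpace G → G) ⁻¹' tsupport f) :=
    isClosed_units.isClosedEmbedding_subtypeVal.isCompact_preimage f.hasCompactSupport.isCompact
  filter_upwards [hK.compl_mem_cocompact] with u hu
  have h0 : expectationFun (ofCc f) u = 0 := by
    rw [expectationFun_ofCc]
    by_contra hne
    exact hu (subset_tsupport _ hne)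
  rw [dist_eq_norm, ← h0]
  exact (norm_expectationFun_sub_le _ _ _).trans_lt hf

/-- The conditional expectation `E : C*_r(G) → C_0(G⁽⁰⁾)`. -/
noncomputable def expectation (a : ReducedCStarAlgebra G) : C₀(UnitSpace G, ℂ) where
  toFun := expectationFun a
  continuous_toFun := continuous_expectationFun a
  zero_at_infty' := tendsto_expectationFun a

variable [MeasurableSpace G]

/-- The functional `τ_μ(a) = ∫ E(a) dμ` on `C*_r(G)`. -/
noncomputable def traceOf (μ : Measure (UnitSpace G)) (a : ReducedCStarAlgebra G) : ℂ :=
  ∫ u, expectation a u ∂μ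

/-- The tracial ideal `I_μ = {a ∈ C*_r(G) : τ_μ(a* a) = 0}`. -/
def tracialIdeal (μ : Measure (UnitSpace G)) : Set (ReducedCStarAlgebra G) :=
  {a | traceOf μ (star a * a) = 0}

end expectation

section invariantMeasure

open IsTopGroupoid

variable {G : Type u} [TopologicalSpace G] [GroupoidOn G]

/-- An open bisection: an open set of arrows on which `src` and `rng` are homeomorphisms onto their
images. -/
structure IsOpenBisection (B : Set G) : Prop where
  isOpen : IsOpen B
  src_embedding : IsEmbedding fun b : B => (src b.1 : UnitSpace G)
  rng_embedding : IsEmbedding fun b : B => (rng b.1 : UnitSpace G)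

/-- The map `α_B : s(B) → r(B)`, `x ↦ r((s|_B)⁻¹(x))`, of a bisection `B`. -/
noncomputable def bisectionMap (B : Set G) (x : (src '' B : Set (UnitSpace G))) : UnitSpace G :=
  rng (Classical.choose x.2)

/-- A measure on the unit space is invariant if `(α_B)_*(μ|_{s(B)}) = μ|_{r(B)}` for every open
bisection `B`. -/
def IsInvariantMeasure [MeasurableSpace G] (μ : Measure (UnitSpace G)) : Prop :=
  ∀ B : Set G, IsOpenBisection B →
    (μ.comap (Subtype.val : (src '' B : Set (UnitSpace G)) → UnitSpace G)).map (bisectionMap B) =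
      μ.restrict (rng '' B)

/-- A set `Y` of units is invariant if `r⁻¹(Y) = s⁻¹(Y)`. -/
def IsInvariantSet {G : Type u} [GroupoidOn G] (Y : Set (UnitSpace G)) : Prop :=
  (rng : G → UnitSpace G) ⁻¹' Y = (src : G → UnitSpace G) ⁻¹' Y

theorem IsInvariantSet.rng_mem {G : Type u} [GroupoidOn G] {Y : Set (UnitSpace G)} (hY : IsInvariantSet Y) {γ : G}
    (h : src γ ∈ Y) : rng γ ∈ Y := by
  have : γ ∈ (src : G → UnitSpace G) ⁻¹' Y := h
  rwa [← hY] at this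

theorem continuous_bisectionMap [IsTopGroupoid G] {B : Set G} (hB : IsOpenBisection B) :
    Continuous (bisectionMap B) := by
  let σ : (src '' B : Set (UnitSpace G)) → B :=
    fun x => ⟨Classical.choose x.2, (Classical.choose_spec x.2).1⟩
  have hσ : Continuous σ := by
    rw [hB.src_embedding.continuous_iff]
    have e : (fun b : B => (src b.1 : UnitSpace G)) ∘ σ = Subtype.val :=
      funext fun x => (Classical.choose_spec x.2).2
    rw [e]
    exact continuous_subtype_val
  exact continuous_rng.comp (continuous_subtype_val.comp hσ)

theorem IsOpenBisection.mono [IsTopGroupoid G] {B B' : Set G} (hB : IsOpenBisection B)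
    (hB' : IsOpen B') (h : B' ⊆ B) : IsOpenBisection B' where
  isOpen := hB'
  src_embedding := hB.src_embedding.comp (IsEmbedding.inclusion h)
  rng_embedding := hB.rng_embedding.comp (IsEmbedding.inclusion h)

theorem exists_isOpenBisection [IsEtale G] (γ : G) : ∃ B : Set G, γ ∈ B ∧ IsOpenBisection B := by
  obtain ⟨U, hU, hUe⟩ :=
    isLocalHomeomorph_iff_isOpenEmbedding_restrict.1 (isLocalHomeomorph_src (G := G)) γ
  obtain ⟨V, hV, hVe⟩ :=
    isLocalHomeomorph_iff_isOpenEmbedding_restrict.1 (IsEtale.isLocalHomeomorph_rng (G := G)) γ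
  have hUV : interior U ∩ interior V ⊆ U :=
    Set.inter_subset_left.trans interior_subset
  have hUV' : interior U ∩ interior V ⊆ V :=
    Set.inter_subset_right.trans interior_subset
  exact ⟨interior U ∩ interior V, ⟨mem_interior_iff_mem_nhds.2 hU, mem_interior_iff_mem_nhds.2 hV⟩,
    isOpen_interior.inter isOpen_interior,
    hUe.isEmbedding.comp (IsEmbedding.inclusion hUV),
    hVe.isEmbedding.comp (IsEmbedding.inclusion hUV')⟩

theorem IsInvariantMeasure.measure_image_eq [IsEtale G] [MeasurableSpace G] [BorelSpace G]
    {μ : Measure (UnitSpace G)} (hμ : IsInvariantMeasure μ) {B : Set G} (hB : IsOpenBisection B) :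
    μ (src '' B) = μ (rng '' B) := by
  have h := congrArg (fun ν => ν Set.univ) (hμ B hB)
  have hs : MeasurableSet (src '' B : Set (UnitSpace G)) :=
    ((isLocalHomeomorph_src (G := G)).isOpenMap _ hB.isOpen).measurableSet
  simp only [Measure.restrict_apply_univ] at h
  rw [Measure.map_apply (continuous_bisectionMap hB).measurable MeasurableSet.univ,
    Set.preimage_univ, comap_subtype_coe_apply hs] at h
  rwa [Set.image_univ, Subtype.range_coe] at h

theorem isInvariantSet_support [IsEtale G] [MeasurableSpace G] [BorelSpace G]
    {μ : Measure (UnitSpace G)} (hμ : IsInvariantMeasure μ) : IsInvariantSet μ.support := by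
  have key : ∀ γ : G, src γ ∈ μ.support → rng γ ∈ μ.support := by
    intro γ hγ
    rw [Measure.mem_support_iff_forall] at hγ ⊢
    intro V hV
    obtain ⟨B, hγB, hB⟩ := exists_isOpenBisection γ
    let W : Set G := B ∩ rng ⁻¹' interior V
    have hW : IsOpenBisection W :=
      hB.mono (hB.isOpen.inter (isOpen_interior.preimage continuous_rng)) Set.inter_subset_left
    have hγW : γ ∈ W := ⟨hγB, mem_interior_iff_mem_nhds.2 hV⟩
    have hpos : 0 < μ (src '' W) :=
      hγ _ (((isLocalHomeomorph_src (G := G)).isOpenMap _ hW.isOpen).mem_nhds ⟨γ, hγW, rfl⟩)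
    rw [hμ.measure_image_eq hW] at hpos
    refine hpos.trans_le (measure_mono ?_)
    rintro _ ⟨a, ha, rfl⟩
    exact interior_subset ha.2
  ext γ
  refine ⟨fun h => ?_, key γ⟩
  have := key (inv γ) (by rw [src_inv]; exact h)
  rwa [rng_inv] at this

instance fact_isClosed_support [MeasurableSpace G] (μ : Measure (UnitSpace G)) :
    Fact (IsClosed μ.support) := ⟨Measure.isClosed_support⟩

end invariantMeasure

/-! ### Reductions to invariant sets of units -/

section reduction

open IsTopGroupoid

variable {G : Type u} [TopologicalSpace G] [GroupoidOn G]

/-- The reduction `G_Y = s⁻¹(Y)` of a groupoid to an invariant set `Y` of units. -/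
def Reduction (Y : Set (UnitSpace G)) (_ : IsInvariantSet Y) : Type u := {γ : G // src γ ∈ Y}

variable {Y : Set (UnitSpace G)} {hY : IsInvariantSet Y}

instance : TopologicalSpace (Reduction Y hY) := instTopologicalSpaceSubtype

instance [T2Space G] : T2Space (Reduction Y hY) := inferInstanceAs (T2Space {γ : G // src γ ∈ Y})

theorem Reduction.ext {G : Type u} [GroupoidOn G] {Y : Set (UnitSpace G)}
    {hY : IsInvariantSet Y} {a b : Reduction Y hY} (h : a.1 = b.1) : a = b := Subtype.ext h

/-- The groupoid structure of `G_Y`, restricted from that of `G`. -/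
instance : GroupoidOn (Reduction Y hY) where
  units := {γ | γ.1 ∈ (units : Set G)}
  src γ := ⟨⟨((src γ.1 : UnitSpace G) : G), by rw [src_unit]; exact γ.2⟩, (src γ.1).2⟩
  rng γ := ⟨⟨((rng γ.1 : UnitSpace G) : G), by rw [src_unit]; exact hY.rng_mem γ.2⟩, (rng γ.1).2⟩
  mul a b h := ⟨mul a.1 b.1 (Subtype.ext (congrArg (fun x => x.1.1) h)), by
    rw [src_mul]; exact b.2⟩
  inv a := ⟨inv a.1, by rw [src_inv]; exact hY.rng_mem a.2⟩
  src_unit x := Subtype.ext (Reduction.ext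
    (congrArg (fun y : UnitSpace G => (y : G)) (src_unit ⟨x.1.1, x.2⟩)))
  rng_unit x := Subtype.ext (Reduction.ext
    (congrArg (fun y : UnitSpace G => (y : G)) (rng_unit ⟨x.1.1, x.2⟩)))
  src_mul a b h := Subtype.ext (Reduction.ext
    (congrArg (fun y : UnitSpace G => (y : G)) (src_mul a.1 b.1 _)))
  rng_mul a b h := Subtype.ext (Reduction.ext
    (congrArg (fun y : UnitSpace G => (y : G))
      (rng_mul a.1 b.1 (Subtype.ext (congrArg (fun x => x.1.1) h)))))
  mul_assoc a b c h h' := Reduction.ext (GroupoidOn.mul_assoc a.1 b.1 c.1 _ _)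
  mul_unit a := Reduction.ext (mul_unit a.1)
  unit_mul a := Reduction.ext (unit_mul a.1)
  src_inv a := Subtype.ext (Reduction.ext
    (congrArg (fun y : UnitSpace G => (y : G)) (src_inv a.1)))
  rng_inv a := Subtype.ext (Reduction.ext
    (congrArg (fun y : UnitSpace G => (y : G)) (rng_inv a.1)))
  inv_mul a := Reduction.ext (inv_mul a.1)
  mul_inv a := Reduction.ext (GroupoidOn.mul_inv a.1)

/-- The inclusion `G_Y⁽⁰⁾ → G⁽⁰⁾`. -/
def Reduction.unitVal (x : UnitSpace (Reduction Y hY)) : UnitSpace G := ⟨x.1.1, x.2⟩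

theorem Reduction.isEmbedding_val :
    IsEmbedding (fun γ : Reduction Y hY => (γ.1 : G)) := IsEmbedding.subtypeVal

theorem Reduction.isEmbedding_unitVal :
    IsEmbedding (Reduction.unitVal : UnitSpace (Reduction Y hY) → UnitSpace G) := by
  refine IsEmbedding.of_comp ?_ continuous_subtype_val
    (Reduction.isEmbedding_val.comp IsEmbedding.subtypeVal)
  exact Continuous.subtype_mk
    (Reduction.isEmbedding_val.continuous.comp continuous_subtype_val) _

theorem Reduction.unitVal_src {G : Type u} [GroupoidOn G] {Y : Set (UnitSpace G)}
    {hY : IsInvariantSet Y} (γ : Reduction Y hY) : Reduction.unitVal (src γ) = src γ.1 := rfl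

theorem Reduction.unitVal_rng {G : Type u} [GroupoidOn G] {Y : Set (UnitSpace G)}
    {hY : IsInvariantSet Y} (γ : Reduction Y hY) : Reduction.unitVal (rng γ) = rng γ.1 := rfl

theorem Reduction.unitVal_mem {G : Type u} [GroupoidOn G] {Y : Set (UnitSpace G)}
    {hY : IsInvariantSet Y} (x : UnitSpace (Reduction Y hY)) : Reduction.unitVal x ∈ Y := by
  have h : src x.1.1 ∈ Y := x.1.2
  have e : src x.1.1 = Reduction.unitVal x := src_unit (Reduction.unitVal x)
  rwa [e] at h

instance [IsTopGroupoid G] : IsTopGroupoid (Reduction Y hY) where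
  continuous_src := Reduction.isEmbedding_unitVal.continuous_iff.2
    (continuous_src.comp Reduction.isEmbedding_val.continuous)
  continuous_rng := Reduction.isEmbedding_unitVal.continuous_iff.2
    (continuous_rng.comp Reduction.isEmbedding_val.continuous)
  continuous_inv := Reduction.isEmbedding_val.continuous_iff.2
    (IsTopGroupoid.continuous_inv.comp Reduction.isEmbedding_val.continuous)
  continuous_mul := by
    refine Reduction.isEmbedding_val.continuous_iff.2 ?_
    have h : Continuous fun p : {p : Reduction Y hY × Reduction Y hY // src p.1 = rng p.2} =>
        ((p.1.1.1, p.1.2.1) : G × G) :=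
      (Reduction.isEmbedding_val.continuous.comp
        (continuous_fst.comp continuous_subtype_val)).prodMk
        (Reduction.isEmbedding_val.continuous.comp (continuous_snd.comp continuous_subtype_val))
    exact IsTopGroupoid.continuous_mul.comp
      (Continuous.subtype_mk h fun p => congrArg Reduction.unitVal p.2)

instance [IsEtale G] : IsEtale (Reduction Y hY) where
  isLocalHomeomorph_rng := by
    rw [isLocalHomeomorph_iff_isOpenEmbedding_restrict]
    intro γ
    obtain ⟨U, hU, hUe⟩ :=
      isLocalHomeomorph_iff_isOpenEmbedding_restrict.1 (IsEtale.isLocalHomeomorph_rng (G := G)) γ.1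
    let V : Set (Reduction Y hY) := (fun γ : Reduction Y hY => (γ.1 : G)) ⁻¹' interior U
    have hV : IsOpen V := isOpen_interior.preimage Reduction.isEmbedding_val.continuous
    have hγV : γ ∈ V := mem_interior_iff_mem_nhds.2 hU
    let i : V → U := fun v => ⟨v.1.1, interior_subset v.2⟩
    have hi : IsEmbedding i := by
      refine IsEmbedding.of_comp ?_ continuous_subtype_val
        (Reduction.isEmbedding_val.comp IsEmbedding.subtypeVal)
      exact Continuous.subtype_mk
        (Reduction.isEmbedding_val.continuous.comp continuous_subtype_val) _
    refine ⟨V, hV.mem_nhds hγV, ?_, ?_⟩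
    · have hc : Continuous fun v : V => (rng v.1 : UnitSpace (Reduction Y hY)) :=
        IsTopGroupoid.continuous_rng.comp continuous_subtype_val
      exact IsEmbedding.of_comp hc Reduction.isEmbedding_unitVal.continuous
        (hUe.isEmbedding.comp hi)
    · have e : Set.range (V.domRestrict (rng : Reduction Y hY → UnitSpace (Reduction Y hY))) =
          Reduction.unitVal ⁻¹' ((rng : G → UnitSpace G) '' interior U) := by
        ext x
        constructor
        · rintro ⟨v, rfl⟩
          exact ⟨v.1.1, v.2, rfl⟩
        · rintro ⟨a, ha, hax⟩
          have haY : src a ∈ Y := by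
            have h1 : a ∈ (rng : G → UnitSpace G) ⁻¹' Y := by
              change rng a ∈ Y
              rw [hax]
              exact Reduction.unitVal_mem x
            rwa [hY] at h1
          exact ⟨⟨⟨a, haY⟩, ha⟩, Reduction.isEmbedding_unitVal.injective hax⟩
      rw [e]
      exact ((IsEtale.isLocalHomeomorph_rng (G := G)).isOpenMap _ isOpen_interior).preimage
        Reduction.isEmbedding_unitVal.continuous

instance [T2Space G] [LocallyCompactSpace G] [IsTopGroupoid G] [hc : Fact (IsClosed Y)] :
    LocallyCompactSpace (Reduction Y hY) :=
  (hc.out.preimage (continuous_src (G := G))).isClosedEmbedding_subtypeVal.locallyCompactSpace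

/-- Restriction of functions `C_c(G) → C_c(G_Y)` for a closed invariant set `Y`. -/
noncomputable def restrictCc [IsTopGroupoid G] [hc : Fact (IsClosed Y)] (hY : IsInvariantSet Y)
    (f : C_c(G, ℂ)) : C_c(Reduction Y hY, ℂ) where
  toFun γ := f γ.1
  continuous_toFun := f.continuous.comp continuous_subtype_val
  hasCompactSupport' := f.hasCompactSupport.comp_isClosedEmbedding
    (hc.out.preimage (continuous_src (G := G))).isClosedEmbedding_subtypeVal

end reduction

end GroupoidCStar

/-!
Since `E(a⋆a)(u) = ‖λ_u(a) δ_u‖²` is continuous in `u` and `supp μ` is conull, `τ_μ(a⋆a) = 0` means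
that `λ_u(a) δ_u = 0` for all `u ∈ supp μ`. Every column of `λ_u(a)` is a right translate of the
column of `λ_v(a)` at `δ_v` for some `v` in the orbit of `u`, so by invariance of `supp μ` this
already forces `λ_u(a) = 0` for all `u ∈ supp μ`. As the fibres of `G` and of its reduction agree
over `supp μ`, the map `π` forgets the operators `λ_u(a)` with `u ∉ supp μ`, and `I_μ = ker π`.

The range of `π` contains the image of `C_c` by Tietze's extension theorem. It is also closed: a
self-adjoint element of the range lifts to one of the same norm, obtained from any self-adjoint
lift by truncating its spectrum.
-/

namespace GroupoidCStar

open GroupoidOn Set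
open scoped CStarAlgebra

section starHom

variable {A B : Type*} [NonUnitalCStarAlgebra A] [NonUnitalCStarAlgebra B]

theorem norm_le_of_mem_quasispectrum {b : B} (hb : IsSelfAdjoint b) {t : ℝ}
    (ht : t ∈ quasispectrum ℝ b) : ‖t‖ ≤ ‖b‖ := by
  simpa only [cfcₙ_id' ℝ b] using norm_apply_le_norm_cfcₙ (𝕜 := ℝ) (fun x : ℝ => x) b ht

theorem exists_map_eq_norm_le_of_isSelfAdjoint (φ : A →⋆ₙₐ[ℂ] B) {a : A} (ha : IsSelfAdjoint a) :
    ∃ a' : A, φ a' = φ a ∧ ‖a'‖ ≤ ‖φ a‖ := by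
  let M := ‖φ a‖
  have hM : 0 ≤ M := norm_nonneg _
  have hφa : IsSelfAdjoint (φ a) := ha.map φ
  let truncation : ℝ → ℝ := fun t => max (-M) (min M t)
  have truncation_cont : Continuous truncation := by fun_prop
  have truncation_zero : truncation 0 = 0 := by simp [truncation, hM]
  have truncation_eq : (quasispectrum ℝ (φ a)).EqOn truncation fun t => t := fun t ht => by
    obtain ⟨hl, hu⟩ : -M ≤ t ∧ t ≤ M := abs_le.1 (norm_le_of_mem_quasispectrum hφa ht)
    simp only [truncation, min_eq_right hu, max_eq_right hl]
  refine ⟨cfcₙ truncation a, ?_, norm_cfcₙ_le fun t _ => ?_⟩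
  · calc φ (cfcₙ truncation a) = cfcₙ truncation (φ a) :=
          NonUnitalStarAlgHomClass.map_cfcₙ (S := ℂ) φ truncation a truncation_cont.continuousOn
            truncation_zero (map_continuous φ) ha hφa
      _ = cfcₙ (fun t : ℝ => t) (φ a) := cfcₙ_congr truncation_eq
      _ = φ a := cfcₙ_id' ℝ (φ a)
  · exact abs_le.2 ⟨le_max_left _ _, max_le (by linarith) (min_le_left _ _)⟩

theorem exists_map_eq_norm_le (φ : A →⋆ₙₐ[ℂ] B) (a : A) :
    ∃ a' : A, φ a' = φ a ∧ ‖a'‖ ≤ 2 * ‖φ a‖ := by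
  obtain ⟨x, hx, hxn⟩ := exists_map_eq_norm_le_of_isSelfAdjoint φ (realPart a).2
  obtain ⟨y, hy, hyn⟩ := exists_map_eq_norm_le_of_isSelfAdjoint φ (imaginaryPart a).2
  rw [map_realPart] at hx hxn
  rw [map_imaginaryPart] at hy hyn
  refine ⟨x + Complex.I • y, ?_, ?_⟩
  · rw [map_add, map_smul, hx, hy, realPart_add_I_smul_imaginaryPart]
  · calc ‖x + Complex.I • y‖ ≤ ‖x‖ + ‖Complex.I • y‖ := norm_add_le _ _
      _ = ‖x‖ + ‖y‖ := by rw [norm_smul, Complex.norm_I, one_mul]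
      _ ≤ ‖φ a‖ + ‖φ a‖ :=
        add_le_add (hxn.trans (realPart.norm_le (φ a))) (hyn.trans (imaginaryPart.norm_le (φ a)))
      _ = 2 * ‖φ a‖ := (two_mul _).symm

theorem isClosed_range_starHom (φ : A →⋆ₙₐ[ℂ] B) : IsClosed (range φ) := by
  let f : NormedAddGroupHom A B := (φ : A →+ B).mkNormedAddGroupHom 1 fun a => by
    rw [one_mul]
    exact NonUnitalStarAlgHom.norm_apply_le φ a
  have lift : f.SurjectiveOnWith f.range 2 := by
    rintro _ ⟨a, rfl⟩
    exact exists_map_eq_norm_le φ a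
  have lift_closure := controlled_closure_of_complete two_pos one_pos lift
  refine isClosed_of_closure_subset fun b hb => ?_
  obtain ⟨a, ha, -⟩ := lift_closure b hb
  exact ⟨a, ha⟩

theorem surjective_of_denseRange (φ : A →⋆ₙₐ[ℂ] B) (hφ : DenseRange φ) :
    Function.Surjective φ :=
  range_eq_univ.1 ((isClosed_range_starHom φ).closure_eq.symm.trans hφ.closure_range)

theorem isClosed_ker_starHom (φ : A →⋆ₙₐ[ℂ] B) : IsClosed (TwoSidedIdeal.ker φ : Set A) := by
  have coe_ker : (TwoSidedIdeal.ker φ : Set A) = φ ⁻¹' {0} := ext fun _ => TwoSidedIdeal.mem_ker φ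
  exact coe_ker ▸ isClosed_singleton.preimage (map_continuous φ)

end starHom

section extension

theorem isClosedEmbedding_onePointMap {X Z : Type*} [TopologicalSpace X] [T2Space X]
    [LocallyCompactSpace X] [TopologicalSpace Z] {i : Z → X} (hi : IsClosedEmbedding i) :
    IsClosedEmbedding (OnePoint.map i) := by
  have : T2Space Z := hi.isEmbedding.t2Space
  have tendsto_i : Tendsto i (coclosedCompact Z) (coclosedCompact X) := by
    simpa only [coclosedCompact_eq_cocompact] using hi.tendsto_cocompact
  exact (OnePoint.continuous_map hi.continuous tendsto_i).isClosedEmbedding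
    (Option.map_injective hi.injective)

theorem exists_compactlySupported_extension {X : Type u} {Z E : Type*} [TopologicalSpace X]
    [T2Space X] [LocallyCompactSpace X] [TopologicalSpace Z] [AddCommGroup E] [Module ℝ E]
    [TopologicalSpace E] [ContinuousSMul ℝ E] [TietzeExtension.{u} E] {i : Z → X}
    (hi : IsClosedEmbedding i) (f : C_c(Z, E)) : ∃ g : C_c(X, E), ∀ z, g (i z) = f z := by
  have : T2Space Z := hi.isEmbedding.t2Space
  have tendsto_f : Tendsto f (coclosedCompact Z) (𝓝 0) := by
    simpa only [coclosedCompact_eq_cocompact] using f.hasCompactSupport.is_zero_at_infty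
  -- `X` need not be normal, but its one-point compactification is; `χ` then restores the compact
  -- support of the extension.
  obtain ⟨F, hF⟩ := ContinuousMap.exists_extension' (isClosedEmbedding_onePointMap hi)
    (OnePoint.continuousMapMk f.toContinuousMap 0 tendsto_f)
  have F_apply (z : Z) : F (i z : OnePoint X) = f z := congrFun hF (z : OnePoint Z)
  obtain ⟨χ, χ_one, -, χ_supp, -⟩ := exists_continuous_one_zero_of_isCompact
    (f.hasCompactSupport.isCompact.image hi.continuous) isClosed_empty (disjoint_empty _)
  have χF_cont : Continuous fun x : X => χ x • F x :=
    χ.continuous.smul (F.continuous.comp OnePoint.continuous_coe)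
  refine ⟨⟨⟨_, χF_cont⟩, χ_supp.smul_right⟩, fun z => ?_⟩
  change χ (i z) • F (i z : OnePoint X) = f z
  rw [F_apply]
  by_cases hz : f z = 0
  · rw [hz, smul_zero]
  · rw [χ_one (mem_image_of_mem i (subset_tsupport _ hz)), Pi.one_apply, one_smul]

end extension

section support

variable {X : Type*} [TopologicalSpace X] [MeasurableSpace X] {μ : Measure X}

theorem ae_eq_iff_eqOn_support {E : Type*} [TopologicalSpace E] [T2Space E]
    (hμ : μ.support ∈ ae μ) {f g : X → E} (hf : Continuous f) (hg : Continuous g) :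
    f =ᵐ[μ] g ↔ EqOn f g μ.support :=
  ⟨fun h => Measure.support_subset_of_isClosed (isClosed_eq hf hg) h, fun h => mem_of_superset hμ h⟩

theorem integral_eq_zero_iff_eqOn_support (hμ : μ.support ∈ ae μ) {f : X → ℝ} (hf : Continuous f)
    (hf_nonneg : 0 ≤ f) (hf_int : Integrable f μ) : ∫ x, f x ∂μ = 0 ↔ EqOn f 0 μ.support :=
  (integral_eq_zero_iff_of_nonneg hf_nonneg hf_int).trans
    (ae_eq_iff_eqOn_support hμ hf continuous_const)

end support

section reindex

variable {ι κ : Type*}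

theorem memℓp_two_comp {e : κ → ι} (he : Function.Injective e) (ξ : Ell2 ι) :
    Memℓp (E := fun _ : κ => ℂ) (fun k => ξ (e k)) 2 :=
  (memℓp_gen_iff (p := 2) (by simp)).2
    (((memℓp_gen_iff (p := 2) (by simp)).1 (lp.memℓp ξ)).comp_injective he)

/-- The unitary `ℓ²(ι) ≃ ℓ²(κ)`, `ξ ↦ ξ ∘ e`, induced by a bijection `e : κ ≃ ι`. It identifies
`ℓ²` of a fibre of a reduction with `ℓ²` of a fibre of the groupoid. -/
noncomputable def reindexEll2 (e : κ ≃ ι) : Ell2 ι ≃ₗᵢ[ℂ] Ell2 κ where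
  toFun ξ := ⟨fun k => ξ (e k), memℓp_two_comp e.injective ξ⟩
  invFun η := ⟨fun i => η (e.symm i), memℓp_two_comp e.symm.injective η⟩
  left_inv ξ := lp.ext (funext fun i => congrArg ξ (e.apply_symm_apply i))
  right_inv η := lp.ext (funext fun k => congrArg η (e.symm_apply_apply k))
  map_add' _ _ := rfl
  map_smul' _ _ := rfl
  norm_map' ξ := by
    rw [lp.norm_eq_tsum_rpow (p := 2) (by simp), lp.norm_eq_tsum_rpow (p := 2) (by simp)]
    congr 1
    exact e.tsum_eq fun i => ‖ξ i‖ ^ (2 : ℝ≥0∞).toReal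

theorem reindexEll2_symm_delta (e : κ ≃ ι) (k : κ) :
    (reindexEll2 e).symm (delta k) = delta (e k) := by
  classical
  refine lp.ext (funext fun i => ?_)
  change (delta k : Ell2 κ) (e.symm i) = delta (e k) i
  simp only [delta, lp.single_apply, Pi.single_apply, e.symm_apply_eq]

end reindex

section restrictOps

variable {G : Type u} [GroupoidOn G] {Y : Set (UnitSpace G)} {hY : IsInvariantSet Y}

theorem Reduction.range_unitVal :
    range (Reduction.unitVal : UnitSpace (Reduction Y hY) → UnitSpace G) = Y := by
  refine Subset.antisymm (range_subset_iff.2 Reduction.unitVal_mem) fun x hx => ?_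
  exact ⟨⟨⟨x, (src_unit x).symm ▸ hx⟩, x.2⟩, rfl⟩

/-- The source fibre of `G_Y` over `x ∈ Y`, as the source fibre of `G` over `x`. -/
def Reduction.fiberEquiv (x : UnitSpace (Reduction Y hY)) :
    Fiber x ≃ Fiber (Reduction.unitVal x) where
  toFun γ := ⟨γ.1.1, congrArg Reduction.unitVal γ.2⟩
  invFun γ := ⟨⟨γ.1, by rw [γ.2]; exact Reduction.unitVal_mem x⟩,
    Subtype.ext (Reduction.ext (congrArg (fun y : UnitSpace G => (y : G)) γ.2))⟩
  left_inv _ := rfl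
  right_inv _ := rfl

/-- The isomorphism `B(ℓ²(G_x)) ≃ B(ℓ²((G_Y)_x))` for `x ∈ Y`. -/
noncomputable def Reduction.fiberConj (x : UnitSpace (Reduction Y hY)) :
    (Ell2 (Fiber (Reduction.unitVal x)) →L[ℂ] Ell2 (Fiber (Reduction.unitVal x))) ≃⋆ₐ[ℂ]
      (Ell2 (Fiber x) →L[ℂ] Ell2 (Fiber x)) :=
  (reindexEll2 (Reduction.fiberEquiv x)).conjStarAlgEquiv

theorem Reduction.fiberConj_delta (x : UnitSpace (Reduction Y hY))
    (T : Ell2 (Fiber (Reduction.unitVal x)) →L[ℂ] Ell2 (Fiber (Reduction.unitVal x)))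
    (γ α : Fiber x) :
    Reduction.fiberConj x T (delta α) γ =
      T (delta (Reduction.fiberEquiv x α)) (Reduction.fiberEquiv x γ) := by
  rw [← reindexEll2_symm_delta]
  rfl

/-- Restriction of a bounded family of operators on the fibres over `G⁽⁰⁾` to the fibres over `Y`;
it induces the restriction homomorphism of the reduced C⋆-algebras. -/
noncomputable def restrictOps (hY : IsInvariantSet Y) :
    FiberOps G →⋆ₙₐ[ℂ] FiberOps (Reduction Y hY) where
  toFun T := ⟨fun x => Reduction.fiberConj x (T.component (Reduction.unitVal x)),
    memℓp_infty ⟨‖T‖, forall_mem_range.2 fun x =>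
      (NonUnitalStarAlgHom.norm_apply_le (Reduction.fiberConj x) _).trans
        (T.norm_component_le _)⟩⟩
  map_smul' c _ := FiberOps.ext fun x => map_smul (Reduction.fiberConj x) c _
  map_zero' := FiberOps.ext fun x => map_zero (Reduction.fiberConj x)
  map_add' _ _ := FiberOps.ext fun x => map_add (Reduction.fiberConj x) _ _
  map_mul' _ _ := FiberOps.ext fun x => map_mul (Reduction.fiberConj x) _ _
  map_star' _ := FiberOps.ext fun x => map_star (Reduction.fiberConj x) _

theorem restrictOps_component (T : FiberOps G) (x : UnitSpace (Reduction Y hY)) :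
    (restrictOps hY T).component x =
      Reduction.fiberConj x (T.component (Reduction.unitVal x)) := rfl

end restrictOps

section restriction

variable {G : Type u} [TopologicalSpace G] [GroupoidOn G] [IsEtale G]
  {Y : Set (UnitSpace G)} [Fact (IsClosed Y)] {hY : IsInvariantSet Y}

theorem restrictOps_regRep (f : C_c(G, ℂ)) :
    restrictOps hY (regRep G f) = regRep _ (restrictCc hY f) := by
  refine FiberOps.ext fun x => ext_delta fun γ α => ?_
  rw [restrictOps_component, Reduction.fiberConj_delta, regRep_apply, regRep_apply,
    leftReg_delta, leftReg_delta]
  rfl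

variable [T2Space G] [LocallyCompactSpace G]

theorem restrictOps_mem_reducedSubalgebra (a : ReducedCStarAlgebra G) :
    restrictOps hY a.1 ∈ reducedSubalgebra (Reduction Y hY) := by
  refine map_mem_closure (s := range (regRep G)) (map_continuous (restrictOps hY)) a.2 ?_
  rintro _ ⟨f, rfl⟩
  exact ⟨restrictCc hY f, (restrictOps_regRep f).symm⟩

/-- The homomorphism `C*_r(G) → C*_r(G_Y)` extending the restriction `C_c(G) → C_c(G_Y)`, for `Y` a
closed invariant set of units. -/
noncomputable def restriction (hY : IsInvariantSet Y) :
    ReducedCStarAlgebra G →⋆ₙₐ[ℂ] ReducedCStarAlgebra (Reduction Y hY) :=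
  NonUnitalStarAlgHom.codRestrict
    ((restrictOps hY).comp (NonUnitalStarSubalgebraClass.subtype (reducedSubalgebra G)))
    (reducedSubalgebra (Reduction Y hY)) restrictOps_mem_reducedSubalgebra

theorem restriction_ofCc (f : C_c(G, ℂ)) :
    restriction hY (ofCc f) = ofCc (restrictCc hY f) := Subtype.ext (restrictOps_regRep f)

theorem evalReg_restriction (a : ReducedCStarAlgebra G) (x : UnitSpace (Reduction Y hY)) :
    evalReg x (restriction hY a) = Reduction.fiberConj x (evalReg (Reduction.unitVal x) a) := rfl

theorem restrictCc_surjective :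
    Function.Surjective (restrictCc hY : C_c(G, ℂ) → C_c(Reduction Y hY, ℂ)) := by
  intro f
  have isClosed_reduction : IsClosed {γ : G | src γ ∈ Y} :=
    (Fact.out : IsClosed Y).preimage IsTopGroupoid.continuous_src
  obtain ⟨g, hg⟩ :=
    exists_compactlySupported_extension isClosed_reduction.isClosedEmbedding_subtypeVal f
  exact ⟨g, CompactlySupportedContinuousMap.ext hg⟩

theorem restriction_surjective :
    Function.Surjective
      (restriction hY : ReducedCStarAlgebra G → ReducedCStarAlgebra (Reduction Y hY)) := by
  refine surjective_of_denseRange _ (denseRange_ofCc.mono (range_subset_iff.2 fun f => ?_))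
  obtain ⟨g, rfl⟩ := restrictCc_surjective f
  exact ⟨ofCc g, restriction_ofCc g⟩

end restriction

section evalReg

variable {G : Type u} [GroupoidOn G]

theorem divR_divR_unit (γ α : G) (h : src γ = src α) :
    divR (divR γ α h) (rng α : G) ((src_divR γ α h).trans (src_unit _).symm) = divR γ α h :=
  (divR_congr _ rfl (congrArg Subtype.val (src_divR γ α h).symm)).trans (divR_unit _)

variable [TopologicalSpace G] [IsEtale G] [T2Space G] [LocallyCompactSpace G]

theorem eq_zero_iff_evalReg_eq_zero {a : ReducedCStarAlgebra G} :
    a = 0 ↔ ∀ x, evalReg x a = 0 :=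
  ⟨fun h _ => h ▸ rfl, fun h => Subtype.ext (FiberOps.ext h)⟩

theorem restriction_eq_zero_iff {Y : Set (UnitSpace G)} [Fact (IsClosed Y)]
    (hY : IsInvariantSet Y) (a : ReducedCStarAlgebra G) :
    restriction hY a = 0 ↔ ∀ x ∈ Y, evalReg x a = 0 := by
  simp only [eq_zero_iff_evalReg_eq_zero, evalReg_restriction, EmbeddingLike.map_eq_zero_iff]
  conv_rhs => rw [← Reduction.range_unitVal (hY := hY)]
  exact (forall_mem_range (p := fun x => evalReg x a = 0)).symm

theorem norm_evalReg_le (x : UnitSpace G) (a : ReducedCStarAlgebra G) : ‖evalReg x a‖ ≤ ‖a‖ :=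
  FiberOps.norm_component_le a.1 x

theorem continuous_evalReg (x : UnitSpace G) :
    Continuous (evalReg x : ReducedCStarAlgebra G → _) :=
  (LipschitzWith.mk_one fun a b => by
    rw [dist_eq_norm, dist_eq_norm]
    exact norm_evalReg_le x (a - b)).continuous

theorem continuous_evalReg_delta (x : UnitSpace G) (γ α : Fiber x) :
    Continuous fun a : ReducedCStarAlgebra G => evalReg x a (delta α) γ := by
  simp only [← inner_delta_left]
  exact continuous_const.inner ((continuous_evalReg x).clm_apply continuous_const)

theorem evalReg_ofCc_delta (f : C_c(G, ℂ)) (x : UnitSpace G) (γ α : Fiber x) :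
    evalReg x (ofCc f) (delta α) γ = f (divR γ.1 α.1 (γ.src_eq α)) := leftReg_delta x f γ α

/-- Right translation by `α` intertwines the regular representations at `s(α)` and `r(α)`. -/
theorem evalReg_delta (a : ReducedCStarAlgebra G) (x : UnitSpace G) (γ α : Fiber x) :
    evalReg x a (delta α) γ = evalReg (rng α.1) a (delta (Fiber.unit (rng α.1)))
      ⟨divR γ.1 α.1 (γ.src_eq α), src_divR _ _ _⟩ := by
  refine congrFun (denseRange_ofCc.equalizer (continuous_evalReg_delta _ _ _)
    (continuous_evalReg_delta _ _ _) (funext fun f => ?_)) a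
  simp only [Function.comp_apply, evalReg_ofCc_delta]
  exact congrArg f (divR_divR_unit γ.1 α.1 (γ.src_eq α)).symm

theorem forall_evalReg_eq_zero_iff {Y : Set (UnitSpace G)} (hY : IsInvariantSet Y)
    (a : ReducedCStarAlgebra G) :
    (∀ x ∈ Y, evalReg x a = 0) ↔ ∀ x ∈ Y, evalReg x a (delta (Fiber.unit x)) = 0 := by
  refine ⟨fun h x hx => by rw [h x hx]; rfl, fun h x hx => ext_delta fun γ α => ?_⟩
  rw [evalReg_delta, h _ (hY.rng_mem (by rw [α.2]; exact hx))]
  rfl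

theorem expectationFun_star_mul_self (a : ReducedCStarAlgebra G) (u : UnitSpace G) :
    expectationFun (star a * a) u = ((‖evalReg u a (delta (Fiber.unit u))‖ ^ 2 : ℝ) : ℂ) := by
  change inner ℂ _ (ContinuousLinearMap.adjoint (evalReg u a) (evalReg u a _)) = _
  rw [ContinuousLinearMap.adjoint_inner_right, inner_self_eq_norm_sq_to_K]
  exact (Complex.ofReal_pow _ 2).symm

theorem continuous_norm_sq_evalReg_delta_unit (a : ReducedCStarAlgebra G) :
    Continuous fun u : UnitSpace G => ‖evalReg u a (delta (Fiber.unit u))‖ ^ 2 := by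
  refine (Complex.continuous_re.comp (continuous_expectationFun (star a * a))).congr fun u => ?_
  rw [Function.comp_apply, expectationFun_star_mul_self, Complex.ofReal_re]

theorem norm_evalReg_delta_le (a : ReducedCStarAlgebra G) (x : UnitSpace G) (γ : Fiber x) :
    ‖evalReg x a (delta γ)‖ ≤ ‖a‖ := by
  simpa only [norm_delta, mul_one] using
    (evalReg x a).le_of_opNorm_le (norm_evalReg_le x a) (delta γ)

end evalReg

section tracialIdeal

variable {G : Type u} [TopologicalSpace G] [GroupoidOn G] [IsEtale G] [T2Space G]
  [LocallyCompactSpace G] [MeasurableSpace G]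

theorem traceOf_star_mul_self (μ : Measure (UnitSpace G)) (a : ReducedCStarAlgebra G) :
    traceOf μ (star a * a) = ((∫ u, ‖evalReg u a (delta (Fiber.unit u))‖ ^ 2 ∂μ : ℝ) : ℂ) :=
  (integral_congr_ae (ae_of_all μ (expectationFun_star_mul_self a))).trans integral_ofReal

variable [BorelSpace G] {μ : Measure (UnitSpace G)} [IsFiniteMeasure μ]

theorem integrable_norm_sq_evalReg_delta_unit (a : ReducedCStarAlgebra G) :
    Integrable (fun u => ‖evalReg u a (delta (Fiber.unit u))‖ ^ 2) μ := by
  refine .of_bound (continuous_norm_sq_evalReg_delta_unit a).aestronglyMeasurable (‖a‖ ^ 2)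
    (ae_of_all μ fun u => ?_)
  rw [norm_pow, norm_norm]
  gcongr
  exact norm_evalReg_delta_le a u _

theorem mem_tracialIdeal_iff (hsupp : μ.support ∈ ae μ) (a : ReducedCStarAlgebra G) :
    a ∈ tracialIdeal μ ↔ ∀ x ∈ μ.support, evalReg x a (delta (Fiber.unit x)) = 0 := by
  change traceOf μ (star a * a) = 0 ↔ _
  rw [traceOf_star_mul_self, Complex.ofReal_eq_zero,
    integral_eq_zero_iff_eqOn_support hsupp (continuous_norm_sq_evalReg_delta_unit a)
      (fun u => sq_nonneg _) (integrable_norm_sq_evalReg_delta_unit a)]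
  simp only [EqOn, Pi.zero_apply, sq_eq_zero_iff, norm_eq_zero]

theorem mem_tracialIdeal_iff_restriction_eq_zero (hsupp : μ.support ∈ ae μ)
    (hμ : IsInvariantMeasure μ) (a : ReducedCStarAlgebra G) :
    a ∈ tracialIdeal μ ↔ restriction (isInvariantSet_support hμ) a = 0 := by
  rw [mem_tracialIdeal_iff hsupp, restriction_eq_zero_iff,
    forall_evalReg_eq_zero_iff (isInvariantSet_support hμ)]

end tracialIdeal

end GroupoidCStar

theorem mainTheorem8_general {G : Type u} [TopologicalSpace G] [T2Space G] [LocallyCompactSpace G]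
    [GroupoidCStar.GroupoidOn G] [GroupoidCStar.IsEtale G] [MeasurableSpace G] [BorelSpace G]
    (μ : Measure (GroupoidCStar.UnitSpace G)) [IsFiniteMeasure μ] (hsupp : μ.support ∈ ae μ)
    (hμ : GroupoidCStar.IsInvariantMeasure μ) :
    ∃ I : TwoSidedIdeal (GroupoidCStar.ReducedCStarAlgebra G),
      IsClosed (I : Set (GroupoidCStar.ReducedCStarAlgebra G)) ∧
      (I : Set (GroupoidCStar.ReducedCStarAlgebra G)) = GroupoidCStar.tracialIdeal μ ∧
      ∃ π : GroupoidCStar.ReducedCStarAlgebra G →⋆ₙₐ[ℂ]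
          GroupoidCStar.ReducedCStarAlgebra
            (GroupoidCStar.Reduction μ.support (GroupoidCStar.isInvariantSet_support hμ)),
        (∀ f : C_c(G, ℂ), π (GroupoidCStar.ofCc f) =
          GroupoidCStar.ofCc
            (GroupoidCStar.restrictCc (GroupoidCStar.isInvariantSet_support hμ) f)) ∧
        Function.Injective (Subtype.val : I → GroupoidCStar.ReducedCStarAlgebra G) ∧
        Function.Exact (Subtype.val : I → GroupoidCStar.ReducedCStarAlgebra G) π ∧
        Function.Surjective π := by
  let π := GroupoidCStar.restriction (GroupoidCStar.isInvariantSet_support hμ)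
  have mem_ker (a) : a ∈ TwoSidedIdeal.ker π ↔ π a = 0 := TwoSidedIdeal.mem_ker π
  have mem_tracialIdeal (a) : a ∈ GroupoidCStar.tracialIdeal μ ↔ π a = 0 :=
    GroupoidCStar.mem_tracialIdeal_iff_restriction_eq_zero hsupp hμ a
  refine ⟨TwoSidedIdeal.ker π, GroupoidCStar.isClosed_ker_starHom π,
    Set.ext fun a => (mem_ker a).trans (mem_tracialIdeal a).symm, π, GroupoidCStar.restriction_ofCc,
    Subtype.val_injective, fun a => ?_, GroupoidCStar.restriction_surjective⟩
  rw [Subtype.range_coe]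
  exact (mem_ker a).symm

theorem mainTheorem8 {G : Type u} [TopologicalSpace G] [T2Space G] [LocallyCompactSpace G]
    [GroupoidCStar.GroupoidOn G] [GroupoidCStar.IsEtale G] [MeasurableSpace G] [BorelSpace G]
    (μ : Measure (GroupoidCStar.UnitSpace G)) [IsProbabilityMeasure μ] [μ.Regular]
    (hμ : GroupoidCStar.IsInvariantMeasure μ) :
    ∃ I : TwoSidedIdeal (GroupoidCStar.ReducedCStarAlgebra G),
      IsClosed (I : Set (GroupoidCStar.ReducedCStarAlgebra G)) ∧
      (I : Set (GroupoidCStar.ReducedCStarAlgebra G)) = GroupoidCStar.tracialIdeal μ ∧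
      ∃ π : GroupoidCStar.ReducedCStarAlgebra G →⋆ₙₐ[ℂ]
          GroupoidCStar.ReducedCStarAlgebra
            (GroupoidCStar.Reduction μ.support (GroupoidCStar.isInvariantSet_support hμ)),
        (∀ f : C_c(G, ℂ), π (GroupoidCStar.ofCc f) =
          GroupoidCStar.ofCc (GroupoidCStar.restrictCc (GroupoidCStar.isInvariantSet_support hμ) f)) ∧
        Function.Injective (Subtype.val : I → GroupoidCStar.ReducedCStarAlgebra G) ∧
        Function.Exact (Subtype.val : I → GroupoidCStar.ReducedCStarAlgebra G) π ∧
        Function.Surjective π :=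
  mainTheorem8_general μ Measure.support_mem_ae_of_regular hμ
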